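/- Let $\mathbf M_k$ denote the algebra of complex $k\times k$ matrices, equipped with the Hilbert--Schmidt inner product $\langle A,B\rangle=\operatorname{Tr}A^*B$. For positive definite $D_1,D_2\in\mathbf M_k$ and a function $f:[0,\infty)\to(0,\infty)$ let $$\mathbb J^f_{D_1,D_2}:=f\bigl(\mathbb L_{D_1}\mathbb R_{D_2}^{-1}\bigr)\,\mathbb R_{D_2}:\mathbf M_k\to\mathbf M_k,\qquad \mathbb L_{D_1}X=D_1X,\quad \mathbb R_{D_2}X=XD_2,$$ where $f$ is applied to the positive self-adjoint operator $\mathbb L_{D_1}\mathbb R_{D_2}^{-1}:X\mapsto D_1XD_2^{-1}$ on the Hilbert space $\mathbf M_k$ by functional calculus. **Theorem.** Let $\beta:\mathbf M_n\to\mathbf M_m$ be a completely positive trace preserving linear map, and let $f:[0,\infty)\to(0,\infty)$ be operator monotone, i.e. $0\le A\le B$ implies $f(A)\le f(B)$ for complex matrices $A,B$ of every size. Assume that $D_1,D_2\in\mathbf M_n$ and $\beta(D_1),\beta(D_2)\in\mathbf M_m$ are positive definite. Then the operators $\mathbb J^f_{D_1,D_2}$ and $\mathbb J^f_{\beta(D_1),\beta(D_2)}$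 are invertible, and $$\beta^*\,\bigl(\mathbb J^f_{\beta(D_1),\beta(D_2)}\bigr)^{-1}\beta\;\le\;\bigl(\mathbb J^f_{D_1,D_2}\bigr)^{-1},$$ where $\beta^*:\mathbf M_m\to\mathbf M_n$ is the adjoint of $\beta$ with respect to the Hilbert--Schmidt inner products, and $S\le T$ means that $T-S$ is a positive semidefinite operator on the Hilbert space $\mathbf M_n$. -/

import Mathlib

open scoped ComplexOrder

namespace QuasiEntropy

noncomputable section

open scoped MatrixOrder

/-- `M n` is the algebra of complex `n × n` matrices. -/
abbrev M (n : ℕ) : Type := Matrix (Fin n) (Fin n) ℂ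

section CompletelyPositive

open scoped Matrix.Norms.L2Operator

/-- A linear map `M n → M m` is completely positive: it underlies one of Mathlib's completely
positive maps between the C⋆-algebras `M n` and `M m` (with the operator norm and the order
`A ≤ B ↔ (B - A).PosSemidef`), i.e. all its entrywise ampliations to `k × k` block matrices
preserve positivity. -/
def IsCompletelyPositive {n m : ℕ} (β : M n →ₗ[ℂ] M m) : Prop :=
  ∃ φ : CompletelyPositiveMap (M n) (M m), φ.toLinearMap = β

theorem nonneg_spectralOrder_iff {C : Type*} [NonUnitalCStarAlgebra C] (x : C) :
    (letI := CStarAlgebra.spectralOrder C; 0 ≤ x) ↔ ∃ s, x = star s * s := by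
  let _ := CStarAlgebra.spectralOrder C
  have _ := CStarAlgebra.spectralOrderedRing C
  exact CStarAlgebra.nonneg_iff_eq_star_mul_self

theorem cstarMatrix_nonneg_iff {n k : ℕ} (X : CStarMatrix (Fin k) (Fin k) (M n)) :
    0 ≤ X ↔ ∃ s, X = star s * s :=
  @nonneg_spectralOrder_iff (CStarMatrix (Fin k) (Fin k) (M n))
    CStarMatrix.instNonUnitalCStarAlgebra X

theorem cstarMatrix_star_mul_apply {n k : ℕ} (s : CStarMatrix (Fin k) (Fin k) (M n))
    (i j : Fin k) (a b : Fin n) :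
    (star s * s) i j a b = ∑ l, ∑ c, star (s l i c a) * s l j c b := by
  simp [CStarMatrix.mul_apply, Matrix.mul_apply, CStarMatrix.star_apply, Matrix.sum_apply]

theorem ofMatrix_nonneg_iff {n k : ℕ} (X : Matrix (Fin k) (Fin k) (M n)) :
    0 ≤ CStarMatrix.ofMatrix X ↔ (Matrix.comp _ _ _ _ ℂ X).PosSemidef := by
  rw [cstarMatrix_nonneg_iff]
  constructor
  · rintro ⟨s, hs⟩
    convert Matrix.posSemidef_conjTranspose_mul_self
      (Matrix.comp _ _ _ _ ℂ (CStarMatrix.ofMatrix.symm s)) using 1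
    ext ⟨i, a⟩ ⟨j, b⟩
    have := congrFun (congrFun (congrFun (congrFun hs i) j) a) b
    rw [cstarMatrix_star_mul_apply] at this
    simp only [Matrix.mul_apply, Fintype.sum_prod_type]
    exact this
  · intro h
    obtain ⟨t, ht⟩ := CStarAlgebra.nonneg_iff_eq_star_mul_self.mp h.nonneg
    refine ⟨CStarMatrix.ofMatrix ((Matrix.comp _ _ _ _ ℂ).symm t), ?_⟩
    ext i j a b
    have := congrFun (congrFun ht (i, a)) (j, b)
    rw [cstarMatrix_star_mul_apply]
    simp only [Matrix.mul_apply, Fintype.sum_prod_type] at this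
    exact this

/-- Complete positivity in terms of block matrices: applying `β` to every block preserves positive
semidefiniteness. -/
theorem isCompletelyPositive_iff {n m : ℕ} (β : M n →ₗ[ℂ] M m) :
    IsCompletelyPositive β ↔ ∀ (k : ℕ) (X : Matrix (Fin k) (Fin k) (M n)),
      (Matrix.comp _ _ _ _ ℂ X).PosSemidef → (Matrix.comp _ _ _ _ ℂ (X.map β)).PosSemidef := by
  constructor
  · rintro ⟨φ, rfl⟩ k X hX
    exact (ofMatrix_nonneg_iff _).mp
      (φ.map_cstarMatrix_nonneg' k _ ((ofMatrix_nonneg_iff X).mpr hX))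
  · intro h
    exact ⟨{ β with map_cstarMatrix_nonneg' := fun k X hX =>
      (ofMatrix_nonneg_iff _).mpr (h k _ ((ofMatrix_nonneg_iff _).mp hX)) }, rfl⟩

end CompletelyPositive

/-- A linear map between matrix algebras is trace preserving. -/
def IsTracePreserving {n m : ℕ} (β : M n →ₗ[ℂ] M m) : Prop :=
  ∀ X : M n, (β X).trace = X.trace

/-- `f` is operator monotone on `[0, ∞)`: `0 ≤ A ≤ B` implies `f(A) ≤ f(B)` for complex matrices
`A`, `B` of every size. Only the values of `f` on `[0, ∞)` matter. -/
def IsOperatorMonotone (f : ℝ → ℝ) : Prop :=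
  ∀ (n : ℕ) (A B : M n), 0 ≤ A → A ≤ B → cfc f A ≤ cfc f B

/-- `HS n` is the vector space `M n`, to be equipped with the Hilbert-Schmidt inner product. -/
def HS (n : ℕ) : Type := M n

instance (n : ℕ) : AddCommGroup (HS n) := inferInstanceAs (AddCommGroup (M n))

instance (n : ℕ) : Module ℂ (HS n) := inferInstanceAs (Module ℂ (M n))

instance (n : ℕ) : FiniteDimensional ℂ (HS n) := inferInstanceAs (FiniteDimensional ℂ (M n))

/-- The identity map from matrices to the Hilbert-Schmidt space. -/
def toHS (n : ℕ) : M n ≃ₗ[ℂ] HS n := LinearEquiv.refl ℂ (M n)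

/-- The Hilbert-Schmidt inner product `⟨B, C⟩ = Tr B* C`. -/
abbrev hsCore (n : ℕ) : InnerProductSpace.Core ℂ (HS n) where
  inner B C := Matrix.trace (((toHS n).symm B).conjTranspose * (toHS n).symm C)
  conj_inner_symm B C := by
    simp [← Matrix.trace_conjTranspose, starRingEnd_apply]
  re_inner_nonneg B :=
    (RCLike.nonneg_iff.mp
      (Matrix.posSemidef_conjTranspose_mul_self ((toHS n).symm B)).trace_nonneg).1
  add_left B C D := by simp [add_mul]
  smul_left B C r := by simp
  definite B h := (toHS n).symm.map_eq_zero_iff.mp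
    (Matrix.trace_conjTranspose_mul_self_eq_zero_iff.mp h)

instance (n : ℕ) : NormedAddCommGroup (HS n) :=
  @InnerProductSpace.Core.toNormedAddCommGroup ℂ (HS n) _ _ _ (hsCore n)

instance (n : ℕ) : InnerProductSpace ℂ (HS n) :=
  @InnerProductSpace.ofCore ℂ (HS n) _ _ _ (hsCore n).toCore

instance (n : ℕ) : CompleteSpace (HS n) := FiniteDimensional.complete ℂ (HS n)

theorem inner_toHS {n : ℕ} (B C : M n) :
    inner ℂ (toHS n B) (toHS n C) = (B.conjTranspose * C).trace := rfl

/-- A linear map between matrix spaces, as an operator between Hilbert-Schmidt spaces. -/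
def onHS {n m : ℕ} (T : M n →ₗ[ℂ] M m) : HS n →L[ℂ] HS m :=
  LinearMap.toContinuousLinearMap ((toHS m).toLinearMap ∘ₗ T ∘ₗ (toHS n).symm.toLinearMap)

theorem onHS_toHS {n m : ℕ} (T : M n →ₗ[ℂ] M m) (X : M n) :
    onHS T (toHS n X) = toHS m (T X) := rfl

/-- Left multiplication `X ↦ D X`. -/
def L {n : ℕ} (D : M n) : HS n →L[ℂ] HS n := onHS (LinearMap.mulLeft ℂ D)

/-- Right multiplication `X ↦ X D`. -/
def R {n : ℕ} (D : M n) : HS n →L[ℂ] HS n := onHS (LinearMap.mulRight ℂ D)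

/-- The operator `J^f_{D₁,D₂} = f(L_{D₁} R_{D₂}⁻¹) R_{D₂}` on the Hilbert-Schmidt space, where `f`
is applied by the functional calculus of self-adjoint operators. -/
def J {n : ℕ} (f : ℝ → ℝ) (D₁ D₂ : M n) : HS n →L[ℂ] HS n :=
  cfc f (L D₁ * Ring.inverse (R D₂)) * R D₂

end

end QuasiEntropy

/-!
The inequality is dual to `β J β† ≤ J'`, where `J` belongs to `D₁, D₂`, `J'` to `β D₁, β D₂`, and
`β†` is the Hilbert-Schmidt adjoint: for positive invertible `A`, `B`, the inequality `T A T† ≤ B`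
implies `T† B⁻¹ T ≤ A⁻¹` (`adjoint_comp_inverse_comp_le`).

Write `Δ = L_{D₁} R_{D₂}⁻¹` and `Δ'` for the relative modular operators of the two pairs. Since `Δ`
commutes with right multiplications by functions of `D₂`, `J = R_{√D₂} f(Δ) R_{√D₂}`, and
`β J β† ≤ J'` is equivalent to `V† f(Δ) V ≤ f(Δ')` for `V = R_{√D₂} β† R_{√(β D₂)}⁻¹`. This
inequality follows from two facts.

* `V† V ≤ 1` and `V† Δ V ≤ Δ'`. They amount to `β R_D β† ≤ R_{β D}` and `β L_D β† ≤ L_{β D}`, that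
  is, to the Schwarz inequality for `β†` in trace form. It comes from the positivity of the `2 × 2`
  block matrix `(1, Y)ᵀ D (1, Yᴴ)` and trace preservation (`IsCompletelyPositive.trace_schwarz`,
  `onHS_R_adjoint_le`, `onHS_L_adjoint_le`).
* Hansen's inequality (`adjoint_cfc_comp_le_of_contraction`): if `V† V ≤ 1` and `0 ≤ A`,
  `V† A V ≤ B`, then `V† f(A) V ≤ f(B)` for `f` operator monotone with `f 0 ≥ 0`. Dilate `V` to
  the isometry `W = (V, √(1 - V†V))` and `A` to `A' = A ⊕ 0`. After an arbitrarily small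
  enlargement, `A'` lies below an operator `C` that is block diagonal for the range of `W` and
  restricts to `B` there; hence `f(A') ≤ f(C)`, and `W† f(C) W = f(B)` because `C W = W B`.
-/

namespace QuasiEntropy

/-! ### Functional calculus on finite-dimensional Hilbert spaces -/

section FunctionalCalculus

variable {H K : Type*} [NormedAddCommGroup H] [InnerProductSpace ℂ H] [FiniteDimensional ℂ H]
  [CompleteSpace H] [NormedAddCommGroup K] [InnerProductSpace ℂ K] [FiniteDimensional ℂ K]
  [CompleteSpace K]

/-- Finiteness makes every function continuous on the spectrum, so `cfc f A` is never a junk value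
for self-adjoint `A`, whatever `f` is. -/
theorem finite_real_spectrum_clm (A : H →L[ℂ] H) : (spectrum ℝ A).Finite := by
  have h : (spectrum ℂ A).Finite := by
    have := Module.End.finite_spectrum (K := ℂ) (V := H) A.toLinearMap
    rwa [ContinuousLinearMap.spectrum_eq] at *
  rw [← spectrum.preimage_algebraMap ℂ]
  exact h.preimage (FaithfulSMul.algebraMap_injective ℝ ℂ).injOn

/-- The functional calculus respects intertwiners: on the two spectra, which are finite, `f` agrees
with a single polynomial. -/
theorem comp_cfc_of_comp_eq {A : H →L[ℂ] H} {B : K →L[ℂ] K} (hA : IsSelfAdjoint A)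
    (hB : IsSelfAdjoint B) {W : K →L[ℂ] H} (h : A ∘L W = W ∘L B) (f : ℝ → ℝ) :
    cfc f A ∘L W = W ∘L cfc f B := by
  classical
  have key : ∀ p : Polynomial ℝ, Polynomial.aeval A p ∘L W = W ∘L Polynomial.aeval B p := by
    intro p
    induction p using Polynomial.induction_on' with
    | add p q hp hq => simp [ContinuousLinearMap.add_comp, hp, hq]
    | monomial k r =>
      have hk : (A ^ k) ∘L W = W ∘L (B ^ k) := by
        induction k with
        | zero => ext; simp
        | succ k ih =>
          rw [pow_succ, pow_succ]
          change (A ^ k) ∘L (A ∘L W) = (W ∘L (B ^ k)) ∘L B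
          rw [h, ← ih, ContinuousLinearMap.comp_assoc]
      rw [Polynomial.aeval_monomial, Polynomial.aeval_monomial, ← Algebra.smul_def,
        ← Algebra.smul_def]
      ext x
      have := congrArg (fun T => T x) hk
      simp at this
      simp [this]
  let s : Finset ℝ := (finite_real_spectrum_clm A).toFinset ∪ (finite_real_spectrum_clm B).toFinset
  let p := Lagrange.interpolate s id f
  have hp : ∀ x ∈ s, f x = p.eval x := fun x hx =>
    (Lagrange.eval_interpolate_at_node f (Function.injective_id.injOn) hx).symm
  have h1 : cfc f A = Polynomial.aeval A p := by
    rw [← cfc_polynomial p A]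
    exact cfc_congr fun x hx => hp x (by simp [s, hx])
  have h2 : cfc f B = Polynomial.aeval B p := by
    rw [← cfc_polynomial p B]
    exact cfc_congr fun x hx => hp x (by simp [s, hx])
  rw [h1, h2, key]

open scoped MatrixOrder in
/-- Operator monotonicity passes from matrices to operators on finite-dimensional Hilbert spaces
by the choice of an orthonormal basis. -/
theorem IsOperatorMonotone.cfc_le_cfc {f : ℝ → ℝ} (hf : IsOperatorMonotone f) {A B : H →L[ℂ] H}
    (hA : 0 ≤ A) (hAB : A ≤ B) : cfc f A ≤ cfc f B := by
  let ψ : (H →L[ℂ] H) ≃⋆ₐ[ℂ] M (Module.finrank ℂ H) :=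
    (stdOrthonormalBasis ℂ H).repr.conjStarAlgEquiv.trans (Matrix.toEuclideanCLM (𝕜 := ℂ)).symm
  have hψ : Continuous ψ := LinearMap.continuous_of_finiteDimensional
    (ψ.toAlgEquiv.toLinearMap)
  have hmap : ∀ T : H →L[ℂ] H, IsSelfAdjoint T → ψ (cfc f T) = cfc f (ψ T) := fun T hT =>
    StarAlgHomClass.map_cfc ψ f T ((finite_real_spectrum_clm T).continuousOn f) hψ hT (hT.map ψ)
  have hB := hA.trans hAB
  have h := hf _ (ψ A) (ψ B) (map_nonneg ψ hA) (OrderHomClass.mono ψ hAB)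
  rw [← hmap A (.of_nonneg hA), ← hmap B (.of_nonneg hB)] at h
  simpa using OrderHomClass.mono ψ.symm h

end FunctionalCalculus

/-! ### Hansen's inequality -/

section Hansen

variable {H K : Type*} [NormedAddCommGroup H] [InnerProductSpace ℂ H]
  [NormedAddCommGroup K] [InnerProductSpace ℂ K]

open ContinuousLinearMap

/-- The inclusion of the first summand into an orthogonal direct sum. -/
noncomputable def sumInl (H K : Type*) [NormedAddCommGroup H] [InnerProductSpace ℂ H]
    [NormedAddCommGroup K] [InnerProductSpace ℂ K] : H →L[ℂ] WithLp 2 (H × K) :=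
  (WithLp.prodContinuousLinearEquiv 2 ℂ H K).symm.toContinuousLinearMap ∘L .inl ℂ H K

/-- The inclusion of the second summand into an orthogonal direct sum. -/
noncomputable def sumInr (H K : Type*) [NormedAddCommGroup H] [InnerProductSpace ℂ H]
    [NormedAddCommGroup K] [InnerProductSpace ℂ K] : K →L[ℂ] WithLp 2 (H × K) :=
  (WithLp.prodContinuousLinearEquiv 2 ℂ H K).symm.toContinuousLinearMap ∘L .inr ℂ H K

theorem fst_sumInl (x : H) : (sumInl H K x).fst = x := rfl
theorem snd_sumInl (x : H) : (sumInl H K x).snd = 0 := rfl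
theorem fst_sumInr (x : K) : (sumInr H K x).fst = 0 := rfl
theorem snd_sumInr (x : K) : (sumInr H K x).snd = x := rfl

variable [CompleteSpace H] [CompleteSpace K]

theorem adjoint_sumInl_apply (x : WithLp 2 (H × K)) : (sumInl H K).adjoint x = x.fst := by
  refine ext_inner_right ℂ fun y => ?_
  rw [adjoint_inner_left]
  simp [sumInl]

theorem adjoint_sumInr_apply (x : WithLp 2 (H × K)) : (sumInr H K).adjoint x = x.snd := by
  refine ext_inner_right ℂ fun y => ?_
  rw [adjoint_inner_left]
  simp [sumInr]

theorem adjoint_comp_comp_mono {A B : H →L[ℂ] H} (h : A ≤ B) (V : K →L[ℂ] H) :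
    V.adjoint ∘L A ∘L V ≤ V.adjoint ∘L B ∘L V := by
  rw [le_def]
  have := IsPositive.adjoint_conj ((le_def _ _).mp h) V
  simpa [sub_comp, comp_sub] using this

theorem adjoint_comp_comp_nonneg {A : H →L[ℂ] H} (h : 0 ≤ A) (V : K →L[ℂ] H) :
    0 ≤ V.adjoint ∘L A ∘L V := by
  simpa using adjoint_comp_comp_mono h V

/-- Inversion reverses the inequality `T A T† ≤ B`. -/
theorem adjoint_comp_inverse_comp_le {A : H →L[ℂ] H} {B : K →L[ℂ] K} (hA : 0 ≤ A) (hAu : IsUnit A)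
    (hB : 0 ≤ B) (hBu : IsUnit B) {T : H →L[ℂ] K} (h : T ∘L A ∘L T.adjoint ≤ B) :
    T.adjoint ∘L Ring.inverse B ∘L T ≤ Ring.inverse A := by
  have hAs : (Ring.inverse A).adjoint = Ring.inverse A := by
    rw [← star_eq_adjoint, ← Ring.inverse_star, (IsSelfAdjoint.of_nonneg hA).star_eq]
  have hBs : (Ring.inverse B).adjoint = Ring.inverse B := by
    rw [← star_eq_adjoint, ← Ring.inverse_star, (IsSelfAdjoint.of_nonneg hB).star_eq]
  have hA1 (x : H) : A (Ring.inverse A x) = x :=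
    congrArg (fun S => S x) (Ring.mul_inverse_cancel A hAu)
  have hA2 (x : H) : Ring.inverse A (A x) = x :=
    congrArg (fun S => S x) (Ring.inverse_mul_cancel A hAu)
  -- The difference of the two sides is `E`, and `E = E A E + T† B⁻¹ (B - T A T†) B⁻¹ T`.
  set E : H →L[ℂ] H := Ring.inverse A - T.adjoint ∘L Ring.inverse B ∘L T with hE
  have hEs : E.adjoint = E := by
    simp [hE, adjoint_comp, hAs, hBs, comp_assoc]
  have h1 : 0 ≤ E.adjoint ∘L A ∘L E := adjoint_comp_comp_nonneg hA E
  have h2 := adjoint_comp_comp_nonneg (sub_nonneg.mpr h) (Ring.inverse B ∘L T)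
  have h3 : Ring.inverse A - T.adjoint ∘L Ring.inverse B ∘L T =
      E.adjoint ∘L A ∘L E + (Ring.inverse B ∘L T).adjoint ∘L (B - T ∘L A ∘L T.adjoint) ∘L
        (Ring.inverse B ∘L T) := by
    rw [hEs, adjoint_comp, hBs]
    have hB1 (x : K) : B (Ring.inverse B x) = x :=
      congrArg (fun S => S x) (Ring.mul_inverse_cancel B hBu)
    ext x
    simp [hE, hA1, hA2, hB1]
  rw [← sub_nonneg, h3]
  exact add_nonneg h1 h2

/-- For an isometry `W`, enlarging the compression `W† A W` by the factor `1 + s ^ 2` leaves room to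
absorb the off-diagonal part of `A` relative to the range of `W`: `A` lies below the block diagonal
operator `W B W† + c (1 - W W†)` for large `c`. -/
theorem le_blockDiagonal_of_isometry {A : H →L[ℂ] H} (hA : 0 ≤ A) {B : K →L[ℂ] K}
    {W : K →L[ℂ] H} (hW : W.adjoint ∘L W = 1) {s : ℝ} (hs : 0 < s)
    (hB : (1 + s ^ 2) • (W.adjoint ∘L A ∘L W) ≤ B) :
    A ≤ W ∘L B ∘L W.adjoint + ((1 + (s ^ 2)⁻¹) * ‖A‖) • (1 - W ∘L W.adjoint) := by
  set P : H →L[ℂ] H := W ∘L W.adjoint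
  have hPstar : star P = P := by simp [P, star_eq_adjoint, adjoint_comp]
  have hPP : P * P = P := by
    change W ∘L (W.adjoint ∘L W) ∘L W.adjoint = P
    rw [hW]; rfl
  have h1 : (1 + s ^ 2) • (P * A * P) ≤ W ∘L B ∘L W.adjoint := by
    have := adjoint_comp_comp_mono hB W.adjoint
    rw [adjoint_adjoint] at this
    refine le_trans (le_of_eq ?_) this
    ext x
    simp [P]
  have h2 : (1 - P) * A * (1 - P) ≤ ‖A‖ • (1 - P) := by
    have := star_left_conjugate_le_conjugate
      (IsSelfAdjoint.le_algebraMap_norm_self (a := A) (.of_nonneg hA)) (1 - P)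
    refine this.trans_eq ?_ |> (le_trans (le_of_eq ?_) ·)
    · simp [hPstar]
    · rw [star_sub, star_one, hPstar, Algebra.algebraMap_eq_smul_one]
      simp [sub_mul, mul_sub, hPP]
  have h3 : 0 ≤ (s • P - s⁻¹ • (1 - P)) * A * (s • P - s⁻¹ • (1 - P)) := by
    have := star_left_conjugate_nonneg hA (s • P - s⁻¹ • (1 - P))
    simpa [hPstar] using this
  -- The weights `s` and `s⁻¹` make the off-diagonal terms of `h3` exactly those of `-A`.
  have h4 : (1 + s ^ 2) • (P * A * P) + (1 + (s ^ 2)⁻¹) • ((1 - P) * A * (1 - P)) - A =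
      (s • P - s⁻¹ • (1 - P)) * A * (s • P - s⁻¹ • (1 - P)) := by
    have : A = P * A * P + P * A * (1 - P) + (1 - P) * A * P + (1 - P) * A * (1 - P) := by
      noncomm_ring
    nth_rw 3 [this]
    generalize 1 - P = Q
    simp only [sub_mul, mul_sub, smul_mul_assoc, mul_smul_comm, smul_sub, smul_smul]
    rw [mul_inv_cancel₀ hs.ne', inv_mul_cancel₀ hs.ne', ← mul_inv, ← pow_two]
    module
  calc A ≤ (1 + s ^ 2) • (P * A * P) + (1 + (s ^ 2)⁻¹) • ((1 - P) * A * (1 - P)) := by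
        rw [← sub_nonneg, h4]; exact h3
    _ ≤ _ := by
        rw [mul_smul]
        gcongr

variable [FiniteDimensional ℂ H] [FiniteDimensional ℂ K]

/-- Hansen's inequality for an isometry `W`, under the stronger hypothesis that `B` dominates
`1 + s ^ 2` times the compression of `A`. -/
theorem adjoint_cfc_comp_le_of_isometry {f : ℝ → ℝ} (hf : IsOperatorMonotone f) {A : H →L[ℂ] H}
    (hA : 0 ≤ A) {B : K →L[ℂ] K} {W : K →L[ℂ] H} (hW : W.adjoint ∘L W = 1) {s : ℝ} (hs : 0 < s)
    (hB : (1 + s ^ 2) • (W.adjoint ∘L A ∘L W) ≤ B) :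
    W.adjoint ∘L cfc f A ∘L W ≤ cfc f B := by
  have hle := le_blockDiagonal_of_isometry hA hW hs hB
  set C := W ∘L B ∘L W.adjoint + ((1 + (s ^ 2)⁻¹) * ‖A‖) • (1 - W ∘L W.adjoint) with hC
  have hB0 : 0 ≤ B := le_trans (smul_nonneg (by positivity) (adjoint_comp_comp_nonneg hA W)) hB
  have hW' (x : K) : W.adjoint (W x) = x := congrArg (fun T => T x) hW
  have hCW : C ∘L W = W ∘L B := by
    ext x
    simp [hC, hW']
  have h := adjoint_comp_comp_mono (hf.cfc_le_cfc hA hle) W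
  rw [comp_cfc_of_comp_eq (.of_nonneg (hA.trans hle)) (.of_nonneg hB0) hCW] at h
  refine h.trans_eq ?_
  ext x
  simp [hW']

/-- Hansen's inequality with a strict enlargement: the contraction `V` is dilated to the isometry
`W x = (V x, √(1 - V†V) x)` and `A` to `A ⊕ 0`. -/
theorem adjoint_cfc_comp_le_of_contraction_of_lt {f : ℝ → ℝ} (hf : IsOperatorMonotone f)
    (hf0 : 0 ≤ f 0) {A : H →L[ℂ] H} (hA : 0 ≤ A) {B : K →L[ℂ] K} {V : K →L[ℂ] H}
    (hV : V.adjoint ∘L V ≤ 1) {s : ℝ} (hs : 0 < s)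
    (hB : (1 + s ^ 2) • (V.adjoint ∘L A ∘L V) ≤ B) :
    V.adjoint ∘L cfc f A ∘L V ≤ cfc f B := by
  set D : K →L[ℂ] K := CFC.sqrt (1 - V.adjoint ∘L V)
  have hDD : D * D = 1 - V.adjoint ∘L V := CFC.sqrt_mul_sqrt_self _ (sub_nonneg.mpr hV)
  have hDs : D.adjoint = D := (IsSelfAdjoint.of_nonneg (CFC.sqrt_nonneg _)).star_eq
  have hDx (x : K) : D (D x) = x - V.adjoint (V x) := congrArg (fun T => T x) hDD
  let I₁ := sumInl H K
  let I₂ := sumInr H K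
  let W : K →L[ℂ] WithLp 2 (H × K) := I₁ ∘L V + I₂ ∘L D
  have hWadj (x : WithLp 2 (H × K)) : W.adjoint x = V.adjoint x.fst + D x.snd := by
    simp [W, I₁, I₂, adjoint_comp, adjoint_sumInl_apply, adjoint_sumInr_apply, hDs]
  have hWx (x : K) : W x = I₁ (V x) + I₂ (D x) := rfl
  have hW : W.adjoint ∘L W = 1 := by
    ext x
    simp [hWadj, hWx, I₁, I₂, fst_sumInl, snd_sumInl, fst_sumInr, snd_sumInr, hDx]
  let A' : WithLp 2 (H × K) →L[ℂ] WithLp 2 (H × K) := I₁ ∘L A ∘L I₁.adjoint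
  have hA' : 0 ≤ A' := by
    have := adjoint_comp_comp_nonneg hA I₁.adjoint
    rwa [adjoint_adjoint] at this
  -- `f (A ⊕ 0) = f(A) ⊕ f(0)`, expressed through the two inclusions.
  have h1 : cfc f A' ∘L I₁ = I₁ ∘L cfc f A := by
    refine comp_cfc_of_comp_eq (.of_nonneg hA') (.of_nonneg hA) ?_ f
    ext1 x
    simp [A', I₁, adjoint_sumInl_apply, fst_sumInl]
  have h2 : cfc f A' ∘L I₂ = I₂ ∘L cfc f (0 : K →L[ℂ] K) := by
    refine comp_cfc_of_comp_eq (.of_nonneg hA') (.zero _) ?_ f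
    ext1 x
    simp [A', I₁, I₂, adjoint_sumInl_apply, fst_sumInr]
  have h1x (x : H) : cfc f A' (I₁ x) = I₁ (cfc f A x) := congrArg (fun T => T x) h1
  have h2x (x : K) : cfc f A' (I₂ x) = I₂ (f 0 • x) := by
    rw [show f 0 • x = cfc f (0 : K →L[ℂ] K) x by
      rw [cfc_apply_zero, Algebra.algebraMap_eq_smul_one]; simp]
    exact congrArg (fun T => T x) h2
  have h := adjoint_cfc_comp_le_of_isometry hf hA' (B := B) hW hs (by
    refine le_trans (le_of_eq ?_) hB
    ext x
    simp [hWadj, hWx, A', I₁, I₂, adjoint_sumInl_apply, fst_sumInl, snd_sumInl, fst_sumInr])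
  refine le_trans ?_ h
  have h3 : W.adjoint ∘L cfc f A' ∘L W = V.adjoint ∘L cfc f A ∘L V + f 0 • (D * D) := by
    ext x
    simp [hWadj, hWx, h1x, h2x]
    simp [I₁, I₂, fst_sumInl, snd_sumInl, fst_sumInr, snd_sumInr]
  rw [h3, hDD]
  exact le_add_of_nonneg_right (smul_nonneg hf0 (sub_nonneg.mpr hV))

/-- Hansen's inequality for an operator monotone function that is nonnegative at `0`. Shrinking
`V` to `t V` with `t < 1` gives the strict case, and `t → 1` needs no continuity of `f`. -/
theorem adjoint_cfc_comp_le_of_contraction {f : ℝ → ℝ} (hf : IsOperatorMonotone f)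
    (hf0 : 0 ≤ f 0) {A : H →L[ℂ] H} (hA : 0 ≤ A) {B : K →L[ℂ] K} {V : K →L[ℂ] H}
    (hV : V.adjoint ∘L V ≤ 1) (hB : V.adjoint ∘L A ∘L V ≤ B) :
    V.adjoint ∘L cfc f A ∘L V ≤ cfc f B := by
  have key (s : ℝ) (hs : 0 < s) : V.adjoint ∘L cfc f A ∘L V ≤ (1 + s ^ 2) • cfc f B := by
    have h0 : 0 < 1 + s ^ 2 := by positivity
    -- The factor `t ^ 2 = (1 + s ^ 2)⁻¹` cancels the enlargement.
    set t : ℝ := (√(1 + s ^ 2))⁻¹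
    have ht : t * t = (1 + s ^ 2)⁻¹ := by
      rw [← mul_inv, Real.mul_self_sqrt h0.le]
    have hconj (T : H →L[ℂ] H) : (t • V).adjoint ∘L T ∘L (t • V) =
        (1 + s ^ 2)⁻¹ • (V.adjoint ∘L T ∘L V) := by
      have hadj : (t • V).adjoint = t • V.adjoint := by
        rw [← Complex.coe_smul, LinearIsometryEquiv.map_smulₛₗ, Complex.conj_ofReal,
          Complex.coe_smul]
      rw [hadj, ← ht]
      ext x
      simp [smul_smul]
    have h := adjoint_cfc_comp_le_of_contraction_of_lt hf hf0 hA (B := B) (V := t • V) (by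
      have h1 := hconj 1
      simp only [one_def, id_comp] at h1
      rw [h1]
      calc (1 + s ^ 2)⁻¹ • (V.adjoint ∘L V) ≤ (1 + s ^ 2)⁻¹ • (1 : K →L[ℂ] K) := by gcongr
        _ ≤ (1 : ℝ) • (1 : K →L[ℂ] K) :=
          smul_le_smul_of_nonneg_right (inv_le_one_of_one_le₀ (by nlinarith)) zero_le_one
        _ = 1 := one_smul _ _) hs (by
      rw [hconj, smul_smul, mul_inv_cancel₀ h0.ne', one_smul]
      exact hB)
    rw [hconj] at h
    have := smul_le_smul_of_nonneg_left h h0.le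
    rwa [smul_smul, mul_inv_cancel₀ h0.ne', one_smul] at this
  have hlim : Filter.Tendsto (fun s : ℝ => (1 + s ^ 2) • cfc f B) (nhdsWithin 0 (Set.Ioi 0))
      (nhds (cfc f B)) := by
    have : Continuous fun s : ℝ => (1 + s ^ 2) • cfc f B := by fun_prop
    simpa using (this.tendsto 0).mono_left nhdsWithin_le_nhds
  exact ge_of_tendsto hlim (Filter.eventually_of_mem self_mem_nhdsWithin key)

end Hansen

/-! ### The Schwarz inequality for completely positive maps -/

section Positivity

open Matrix

variable {n m : ℕ} {β : M n →ₗ[ℂ] M m}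

/-- The block matrix `(1, Y)ᵀ D (1, Yᴴ)`. -/
def blockConj (D Y : M n) : Matrix (Fin 2) (Fin 2) (M n) :=
  !![D, D * Yᴴ; Y * D, Y * D * Yᴴ]

theorem posSemidef_blockConj {D : M n} (hD : D.PosSemidef) (Y : M n) :
    (Matrix.comp _ _ _ _ ℂ (blockConj D Y)).PosSemidef := by
  let G : Matrix (Fin n) (Fin 2 × Fin n) ℂ := .of fun a j => (![1, Yᴴ] j.1) a j.2
  convert hD.conjTranspose_mul_mul_same G using 1
  have hG (i j : Fin 2) (a b : Fin n) :
      (Gᴴ * D * G) (i, a) (j, b) = ((![1, Yᴴ] i)ᴴ * D * (![1, Yᴴ] j)) a b := rfl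
  ext ⟨i, a⟩ ⟨j, b⟩
  rw [hG]
  fin_cases i <;> fin_cases j <;> simp [blockConj]

theorem IsCompletelyPositive.map_conjTranspose (hβ : IsCompletelyPositive β) (Z : M n) :
    β Zᴴ = (β Z)ᴴ := by
  have h := ((isCompletelyPositive_iff β).mp hβ 2 _
    (posSemidef_blockConj (D := 1) PosSemidef.one Z)).isHermitian
  -- Compare the two off-diagonal blocks.
  ext a b
  simpa [blockConj] using (h.apply (0, a) (1, b)).symm

/-- The trace form of the Schwarz inequality: `β` is applied to `(1, Y)ᵀ D (1, Yᴴ)` and the result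
is compressed by the block vector `(X, -1)`. -/
theorem IsCompletelyPositive.trace_schwarz (hβ : IsCompletelyPositive β) {D : M n}
    (hD : D.PosSemidef) (X : M m) (Y : M n) :
    0 ≤ (X * β D * Xᴴ - X * β (D * Yᴴ) - β (Y * D) * Xᴴ + β (Y * D * Yᴴ)).trace := by
  have h := (isCompletelyPositive_iff β).mp hβ 2 _ (posSemidef_blockConj hD Y)
  -- The block column `(Xᴴ, -1)`.
  let G : Matrix (Fin 2 × Fin m) (Fin m) ℂ := .of fun i a => (![Xᴴ, -1] i.1) i.2 a
  have h' := (h.conjTranspose_mul_mul_same G).trace_nonneg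
  have hG : Gᴴ * Matrix.comp _ _ _ _ ℂ ((blockConj D Y).map β) * G =
      ∑ j, (∑ i, (![Xᴴ, -1] i)ᴴ * β (blockConj D Y i j)) * ![Xᴴ, -1] j := by
    ext a b
    simp only [Matrix.mul_apply, Fintype.sum_prod_type, Matrix.sum_apply]
    rfl
  rw [hG] at h'
  convert h' using 1
  congr 1
  simp [Fin.sum_univ_two, blockConj, add_mul]
  abel

end Positivity

/-! ### Multiplication operators and the adjoint of a channel on the Hilbert-Schmidt space -/

section HilbertSchmidt

open ContinuousLinearMap

variable {n m : ℕ}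

theorem L_toHS (D X : M n) : L D (toHS n X) = toHS n (D * X) := rfl
theorem R_toHS (D X : M n) : R D (toHS n X) = toHS n (X * D) := rfl

theorem adjoint_L (D : M n) : (L D).adjoint = L D.conjTranspose := by
  symm
  rw [eq_adjoint_iff]
  intro x y
  obtain ⟨X, rfl⟩ := (toHS n).surjective x
  obtain ⟨Y, rfl⟩ := (toHS n).surjective y
  simp [L_toHS, inner_toHS, Matrix.mul_assoc]

theorem adjoint_R (D : M n) : (R D).adjoint = R D.conjTranspose := by
  symm
  rw [eq_adjoint_iff]
  intro x y
  obtain ⟨X, rfl⟩ := (toHS n).surjective x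
  obtain ⟨Y, rfl⟩ := (toHS n).surjective y
  rw [R_toHS, R_toHS, inner_toHS, inner_toHS, Matrix.conjTranspose_mul,
    Matrix.conjTranspose_conjTranspose, Matrix.mul_assoc, Matrix.trace_mul_comm, Matrix.mul_assoc]

theorem L_mul (C D : M n) : L (C * D) = L C * L D := by
  ext x
  exact Matrix.mul_assoc C D ((toHS n).symm x)

theorem R_mul (C D : M n) : R (C * D) = R D * R C := by
  ext x
  exact (Matrix.mul_assoc ((toHS n).symm x) C D).symm

theorem R_one : R (1 : M n) = 1 := by
  ext x
  exact Matrix.mul_one ((toHS n).symm x)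

theorem commute_L_R (C D : M n) : Commute (L C) (R D) := by
  ext x
  exact (Matrix.mul_assoc C ((toHS n).symm x) D).symm

theorem isUnit_R {D : M n} (hD : IsUnit D) : IsUnit (R D) := by
  obtain ⟨u, rfl⟩ := hD
  exact ⟨⟨R u, R (↑u⁻¹ : M n), by rw [← R_mul, Units.inv_mul, R_one],
    by rw [← R_mul, Units.mul_inv, R_one]⟩, rfl⟩

theorem L_nonneg {D : M n} (hD : D.PosSemidef) : 0 ≤ L D := by
  open scoped MatrixOrder in
  obtain ⟨T, rfl⟩ := CStarAlgebra.nonneg_iff_eq_star_mul_self.mp hD.nonneg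
  rw [L_mul, Matrix.star_eq_conjTranspose, ← adjoint_L]
  exact star_mul_self_nonneg (L T)

/-- A positive definite matrix has an invertible self-adjoint square root; all that is needed of
it here is that `R S` is then an invertible self-adjoint square root of `R D`. -/
theorem exists_sqrt {D : M n} (hD : D.PosDef) :
    ∃ S : M n, S.conjTranspose = S ∧ S * S = D ∧ IsUnit S := by
  open scoped MatrixOrder in
  have h : CFC.sqrt D * CFC.sqrt D = D := CFC.sqrt_mul_sqrt_self D hD.posSemidef.nonneg
  refine ⟨CFC.sqrt D, (IsSelfAdjoint.of_nonneg (CFC.sqrt_nonneg D)).star_eq, h, ?_⟩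
  rw [← isUnit_mul_self_iff, h]
  exact hD.isUnit

variable {β : M n →ₗ[ℂ] M m}

theorem trace_adjoint_onHS (β : M n →ₗ[ℂ] M m) (X : M m) (Z : M n) :
    ((((toHS n).symm ((onHS β).adjoint (toHS m X))).conjTranspose) * Z).trace =
      (X.conjTranspose * β Z).trace :=
  adjoint_inner_left (onHS β) (toHS n Z) (toHS m X)

open Matrix in
/-- The form of `trace_schwarz` in which `Y` is the Hilbert-Schmidt adjoint of `β` applied
to `X`. -/
theorem trace_le_of_adjoint (hβ : IsCompletelyPositive β) (htr : IsTracePreserving β) {D : M n}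
    (hD : D.PosSemidef) {X : M m} {Y : M n} (h : ∀ Z, (Yᴴ * Z).trace = (Xᴴ * β Z).trace) :
    (Yᴴ * (Y * D)).trace ≤ (Xᴴ * (X * β D)).trace := by
  have key := hβ.trace_schwarz hD X Y
  have h1 : (β (Y * D) * Xᴴ).trace = (Yᴴ * (Y * D)).trace := by
    rw [Matrix.trace_mul_comm, h]
  have h2 : (X * β (D * Yᴴ)).trace = (Yᴴ * (Y * D)).trace := by
    have : X * β (D * Yᴴ) = (β (Y * D) * Xᴴ)ᴴ := by
      rw [conjTranspose_mul, conjTranspose_conjTranspose, ← hβ.map_conjTranspose, conjTranspose_mul,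
        hD.isHermitian.eq]
    rw [this, trace_conjTranspose, h1, ← trace_conjTranspose, conjTranspose_mul, conjTranspose_mul,
      conjTranspose_conjTranspose, hD.isHermitian.eq, Matrix.mul_assoc, Matrix.trace_mul_comm,
      Matrix.mul_assoc]
  have h3 : (β (Y * D * Yᴴ)).trace = (Yᴴ * (Y * D)).trace := by
    rw [htr, Matrix.trace_mul_comm]
  have h4 : (X * β D * Xᴴ).trace = (Xᴴ * (X * β D)).trace := Matrix.trace_mul_comm _ _
  rw [trace_add, trace_sub, trace_sub, h1, h2, h3, h4] at key
  simpa using key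

open Matrix in
/-- The left-multiplication version, obtained by applying the other one to `Xᴴ` and `Yᴴ`. -/
theorem trace_le_of_adjoint' (hβ : IsCompletelyPositive β) (htr : IsTracePreserving β) {D : M n}
    (hD : D.PosSemidef) {X : M m} {Y : M n} (h : ∀ Z, (Yᴴ * Z).trace = (Xᴴ * β Z).trace) :
    (Yᴴ * (D * Y)).trace ≤ (Xᴴ * (β D * X)).trace := by
  have hstar (Z : M n) : (Yᴴᴴ * Z).trace = (Xᴴᴴ * β Z).trace := by
    have := congrArg star (h Zᴴ)
    rwa [hβ.map_conjTranspose, ← trace_conjTranspose, ← trace_conjTranspose, conjTranspose_mul,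
      conjTranspose_mul, conjTranspose_conjTranspose Z, conjTranspose_conjTranspose (β Z),
      trace_mul_comm, trace_mul_comm (β Z)] at this
  have key := trace_le_of_adjoint hβ htr hD hstar
  rwa [conjTranspose_conjTranspose, conjTranspose_conjTranspose, trace_mul_comm,
    trace_mul_comm X, Matrix.mul_assoc, Matrix.mul_assoc] at key

theorem le_of_inner_le {H : Type*} [NormedAddCommGroup H] [InnerProductSpace ℂ H]
    {S T : H →L[ℂ] H} (h : ∀ x, inner ℂ x (S x) ≤ inner ℂ x (T x)) : S ≤ T := by
  rw [le_def, isPositive_iff_complex]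
  intro x
  have hx : 0 ≤ inner ℂ x ((T - S) x) := by
    rw [sub_apply, inner_sub_right]
    exact sub_nonneg.mpr (h x)
  rw [← inner_conj_symm, (Complex.conj_eq_iff_im.mpr (Complex.nonneg_iff.mp hx).2.symm)]
  exact ⟨(Complex.ext rfl (Complex.nonneg_iff.mp hx).2), (Complex.nonneg_iff.mp hx).1⟩

/-- Makes `R_{√D₂} β† R_{√(β D₂)}⁻¹` a contraction. -/
theorem onHS_R_adjoint_le (hβ : IsCompletelyPositive β) (htr : IsTracePreserving β) {D : M n}
    (hD : D.PosSemidef) : onHS β ∘L R D ∘L (onHS β).adjoint ≤ R (β D) := by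
  refine le_of_inner_le fun x => ?_
  obtain ⟨X, rfl⟩ := (toHS m).surjective x
  have h := trace_le_of_adjoint hβ htr hD (trace_adjoint_onHS β X)
  rw [trace_adjoint_onHS] at h
  exact h

/-- Bounds the compression of the relative modular operator by that of the images. -/
theorem onHS_L_adjoint_le (hβ : IsCompletelyPositive β) (htr : IsTracePreserving β) {D : M n}
    (hD : D.PosSemidef) : onHS β ∘L L D ∘L (onHS β).adjoint ≤ L (β D) := by
  refine le_of_inner_le fun x => ?_
  obtain ⟨X, rfl⟩ := (toHS m).surjective x
  have h := trace_le_of_adjoint' hβ htr hD (trace_adjoint_onHS β X)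
  rw [trace_adjoint_onHS] at h
  exact h

/-! ### The relative modular operator and `J` -/

/-- The relative modular operator `L_{D₁} R_{D₂}⁻¹`. -/
noncomputable def modularOp (D₁ D₂ : M n) : HS n →L[ℂ] HS n := L D₁ * Ring.inverse (R D₂)

theorem J_eq (f : ℝ → ℝ) (D₁ D₂ : M n) : J f D₁ D₂ = cfc f (modularOp D₁ D₂) * R D₂ := rfl

theorem adjoint_ringInverse_R {S : M n} (hS : S.conjTranspose = S) :
    (Ring.inverse (R S)).adjoint = Ring.inverse (R S) := by
  rw [← star_eq_adjoint, ← Ring.inverse_star, star_eq_adjoint, adjoint_R, hS]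

theorem commute_ringInverse {A : Type*} [Ring A] {a b : A} (hb : IsUnit b) (h : Commute a b) :
    Commute a (Ring.inverse b) := by
  obtain ⟨u, rfl⟩ := hb
  rw [Ring.inverse_unit]
  exact h.units_inv_right

theorem modularOp_eq_conj {D₁ S : M n} (hS : IsUnit S) :
    modularOp D₁ (S * S) = Ring.inverse (R S) * L D₁ * Ring.inverse (R S) := by
  have hc : Commute (L D₁) (Ring.inverse (R S)) :=
    commute_ringInverse (isUnit_R hS) (commute_L_R D₁ S)
  rw [modularOp, R_mul, Ring.mul_inverse_rev' (Commute.refl _), ← mul_assoc, hc.eq]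

theorem modularOp_nonneg {D₁ D₂ : M n} (hD₁ : D₁.PosSemidef) (hD₂ : D₂.PosDef) :
    0 ≤ modularOp D₁ D₂ := by
  obtain ⟨S, hS, rfl, hSu⟩ := exists_sqrt hD₂
  rw [modularOp_eq_conj hSu]
  have := star_left_conjugate_nonneg (L_nonneg hD₁) (Ring.inverse (R S))
  rwa [star_eq_adjoint, adjoint_ringInverse_R hS] at this

/-- The symmetric form `R_S f(L_{D₁} R_{S²}⁻¹) R_S` of `J`. -/
theorem J_eq_conj (f : ℝ → ℝ) (D₁ : M n) {S : M n} (hS : IsUnit S) :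
    J f D₁ (S * S) = R S * cfc f (modularOp D₁ (S * S)) * R S := by
  have hc : Commute (modularOp D₁ (S * S)) (R S) := by
    rw [modularOp_eq_conj hS]
    have h : Commute (Ring.inverse (R S)) (R S) :=
      (commute_ringInverse (isUnit_R hS) (.refl _)).symm
    exact (h.mul_left (commute_L_R D₁ S)).mul_left h
  rw [J_eq, R_mul, ← mul_assoc, (hc.cfc_real f).eq]

theorem J_nonneg {f : ℝ → ℝ} (hf : ∀ x, 0 ≤ x → 0 < f x) {D₁ D₂ : M n} (hD₁ : D₁.PosSemidef)
    (hD₂ : D₂.PosDef) : 0 ≤ J f D₁ D₂ := by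
  have h0 := modularOp_nonneg hD₁ hD₂
  obtain ⟨S, hS, rfl, hSu⟩ := exists_sqrt hD₂
  rw [J_eq_conj f D₁ hSu]
  have := star_left_conjugate_nonneg
    (cfc_nonneg fun x hx => (hf x (spectrum_nonneg_of_nonneg h0 hx)).le) (R S)
  rwa [star_eq_adjoint, adjoint_R, hS] at this

theorem isUnit_J {f : ℝ → ℝ} (hf : ∀ x, 0 ≤ x → 0 < f x) {D₁ D₂ : M n} (hD₁ : D₁.PosSemidef)
    (hD₂ : D₂.PosDef) : IsUnit (J f D₁ D₂) := by
  have h0 := modularOp_nonneg hD₁ hD₂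
  refine IsUnit.mul ?_ (isUnit_R hD₂.isUnit)
  exact (isUnit_cfc_iff f (modularOp D₁ D₂) ((finite_real_spectrum_clm _).continuousOn f)
    (.of_nonneg h0)).mpr fun x hx => (hf x (spectrum_nonneg_of_nonneg h0 hx)).ne'

/-- The inequality `β J β† ≤ J'`, dual to monotonicity: Hansen's inequality for the contraction
`R_{√D₂} β† R_{√(β D₂)}⁻¹`. -/
theorem onHS_J_adjoint_le (hβ : IsCompletelyPositive β) (htr : IsTracePreserving β) {f : ℝ → ℝ}
    (hfpos : ∀ x, 0 ≤ x → 0 < f x) (hf : IsOperatorMonotone f) {D₁ D₂ : M n} (hD₁ : D₁.PosSemidef)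
    (hD₂ : D₂.PosDef) (hβD₂ : (β D₂).PosDef) :
    onHS β ∘L J f D₁ D₂ ∘L (onHS β).adjoint ≤ J f (β D₁) (β D₂) := by
  have h0 := modularOp_nonneg hD₁ hD₂
  obtain ⟨S, hS, hSS, hSu⟩ := exists_sqrt hD₂
  obtain ⟨S', hS', hSS', hSu'⟩ := exists_sqrt hβD₂
  set Q := Ring.inverse (R S')
  have hQs : Q.adjoint = Q := adjoint_ringInverse_R hS'
  have hRs : (R S).adjoint = R S := by rw [adjoint_R, hS]
  have hRs' : (R S').adjoint = R S' := by rw [adjoint_R, hS']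
  have hQR (x : HS m) : Q (R S' x) = x :=
    congrArg (fun T => T x) (Ring.inverse_mul_cancel _ (isUnit_R hSu'))
  have hRQ (x : HS m) : R S' (Q x) = x :=
    congrArg (fun T => T x) (Ring.mul_inverse_cancel _ (isUnit_R hSu'))
  have hQR' (x : HS n) : Ring.inverse (R S) (R S x) = x :=
    congrArg (fun T => T x) (Ring.inverse_mul_cancel _ (isUnit_R hSu))
  have hRQ' (x : HS n) : R S (Ring.inverse (R S) x) = x :=
    congrArg (fun T => T x) (Ring.mul_inverse_cancel _ (isUnit_R hSu))
  let V : HS m →L[ℂ] HS n := R S ∘L (onHS β).adjoint ∘L Q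
  have hVadj : V.adjoint = Q ∘L onHS β ∘L R S := by
    simp [V, adjoint_comp, hQs, hRs, comp_assoc]
  have hV : V.adjoint ∘L V ≤ 1 := by
    have h := adjoint_comp_comp_mono (onHS_R_adjoint_le hβ htr hD₂.posSemidef) Q
    rw [hQs] at h
    refine (le_of_eq ?_).trans (h.trans_eq ?_)
    · rw [← hSS, R_mul, hVadj]
      rfl
    · rw [← hSS', R_mul]
      ext1 x
      simp [hQR, hRQ]
  have hVΔ : V.adjoint ∘L modularOp D₁ D₂ ∘L V ≤ modularOp (β D₁) (β D₂) := by
    have h := adjoint_comp_comp_mono (onHS_L_adjoint_le hβ htr hD₁) Q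
    rw [hQs] at h
    refine (le_of_eq ?_).trans (h.trans_eq ?_)
    · rw [← hSS, modularOp_eq_conj hSu, hVadj]
      ext x
      simp [V, hQR', hRQ']
    · rw [← hSS', modularOp_eq_conj hSu']
      rfl
  have h := adjoint_comp_comp_mono
    (adjoint_cfc_comp_le_of_contraction hf (hfpos 0 le_rfl).le h0 hV hVΔ) (R S')
  refine (le_of_eq ?_).trans (h.trans_eq ?_)
  · rw [← hSS, J_eq_conj f D₁ hSu, hRs', hVadj]
    ext1 x
    simp [V, hRQ, hQR]
  · rw [← hSS', J_eq_conj f (β D₁) hSu', hRs']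
    rfl

end HilbertSchmidt

end QuasiEntropy

/-! ### Monotonicity -/

/-- Monotonicity of the two-parameter monotone metric. The order is the Loewner order of operators
on the Hilbert-Schmidt space, and the adjoint is taken for the Hilbert-Schmidt inner products. The
operators `J` being inverted are invertible, which is part of the claim. -/
theorem mainTheorem1 (n m : ℕ)
    (β : QuasiEntropy.M n →ₗ[ℂ] QuasiEntropy.M m)
    (hcp : QuasiEntropy.IsCompletelyPositive β) (htr : QuasiEntropy.IsTracePreserving β)
    (f : ℝ → ℝ) (hfpos : ∀ x : ℝ, 0 ≤ x → 0 < f x) (hf : QuasiEntropy.IsOperatorMonotone f)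
    (D₁ D₂ : QuasiEntropy.M n) (hD₁ : D₁.PosDef) (hD₂ : D₂.PosDef)
    (hβD₁ : (β D₁).PosDef) (hβD₂ : (β D₂).PosDef) :
    IsUnit (QuasiEntropy.J f D₁ D₂) ∧ IsUnit (QuasiEntropy.J f (β D₁) (β D₂)) ∧
      (QuasiEntropy.onHS β).adjoint ∘L Ring.inverse (QuasiEntropy.J f (β D₁) (β D₂)) ∘L
          QuasiEntropy.onHS β ≤
        Ring.inverse (QuasiEntropy.J f D₁ D₂) := by
  have hJ := QuasiEntropy.isUnit_J hfpos hD₁.posSemidef hD₂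
  have hJ' := QuasiEntropy.isUnit_J hfpos hβD₁.posSemidef hβD₂
  exact ⟨hJ, hJ', QuasiEntropy.adjoint_comp_inverse_comp_le
    (QuasiEntropy.J_nonneg hfpos hD₁.posSemidef hD₂) hJ
    (QuasiEntropy.J_nonneg hfpos hβD₁.posSemidef hβD₂) hJ'
    (QuasiEntropy.onHS_J_adjoint_le hcp htr hfpos hf hD₁.posSemidef hD₂ hβD₂)⟩
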